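/- Let $B$ be a nonempty finite set and let $\omega=\{0,1,2,\dots\}$. Call the functions $f\in\omega^B$ multisets; the total size of $f$ is $\sum_{b\in B} f(b)$. For $T\in\omega$ let $\mu_T$ be the probability measure on $\omega^B$ that is uniform on the (finite, nonempty) set of multisets of total size $T$ and zero elsewhere. For $b\in B$ let $e_b\in\omega^B$ be given by $e_b(b)=1$ and $e_b(c)=0$ for $c\neq b$, and for $S\subseteq\omega^B$ let the shadow of $S$ be $$\partial S=\{f\in\omega^B \mid f+e_b\in S\text{ for some } b\in B\}.$$ Then for every $T\in\omega$, every real $x\ge 0$ and every $S\subseteq\omega^B$, $$\text{if } \mu_{T+1}(S)\ge \frac{x}{T+1+x},\quad\text{then}\quad \mu_T(\partial S)\ge \frac{x}{T+x},$$ where $0/0$ is taken to be $0$ in the case $T=x=0$. -/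

import Mathlib

open MeasureTheory ProbabilityTheory

/-- The unit multiset `e_b`, viewed as a function `B → ℕ` taking value `1` at `b` and `0` elsewhere,
is `Pi.single b 1`. The shadow `∂S` of a set `S` of multisets on `B` is the set of all multisets `f`
such that `f + e_b ∈ S` for some `b`. -/
def multisetShadow {B : Type*} [DecidableEq B] (S : Set (B → ℕ)) : Set (B → ℕ) :=
  {f | ∃ b : B, f + Pi.single b 1 ∈ S}

/-- The multisets in `S` of total size `T`. -/
def multisetLevel {B : Type*} [Fintype B] (S : Set (B → ℕ)) (T : ℕ) : Set (B → ℕ) :=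
  {f | f ∈ S ∧ ∑ b, f b = T}

/-- The measure on multisets on `B` that is uniform on the multisets of total size `T`
and zero elsewhere. -/
noncomputable def multisetUniform (B : Type*) [Fintype B] (T : ℕ) : Measure (B → ℕ) :=
  uniformOn (multisetLevel Set.univ T)

namespace MultisetShadow

open Finset

set_option linter.unusedSectionVars false

variable {ι : Type*} [Fintype ι] [DecidableEq ι]

/-- The upper shadow of `V`: all multisets obtained by adding one element of `A` to some `f ∈ V`. -/
def up (A : Finset ι) (V : Finset (ι → ℕ)) : Finset (ι → ℕ) :=
  A.biUnion fun b => V.image fun f => f + Pi.single b 1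

/-- The link of `b` in `V`: all multisets `f` with `f + e_b ∈ V`. -/
noncomputable def link (V : Finset (ι → ℕ)) (b : ι) : Finset (ι → ℕ) :=
  V.preimage (fun f => f + Pi.single b 1) (add_left_injective _).injOn

theorem mem_up {A : Finset ι} {V : Finset (ι → ℕ)} {g : ι → ℕ} :
    g ∈ up A V ↔ ∃ b ∈ A, ∃ f ∈ V, f + Pi.single b 1 = g := by
  simp [up]

theorem add_single_mem_up {A : Finset ι} {V : Finset (ι → ℕ)} {f : ι → ℕ} {b : ι}
    (hb : b ∈ A) (hf : f ∈ V) : f + Pi.single b 1 ∈ up A V :=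
  mem_up.2 ⟨b, hb, f, hf, rfl⟩

theorem mem_link {V : Finset (ι → ℕ)} {b : ι} {f : ι → ℕ} :
    f ∈ link V b ↔ f + Pi.single b 1 ∈ V := by
  simp [link]

theorem add_single_mem_piAntidiag {A : Finset ι} {T : ℕ} {f : ι → ℕ} {b : ι} (hb : b ∈ A) :
    f + Pi.single b 1 ∈ piAntidiag A (T + 1) ↔ f ∈ piAntidiag A T := by
  simp only [mem_piAntidiag, Pi.add_apply, sum_add_distrib, sum_pi_single', hb, if_true,
    add_left_inj]
  refine and_congr_right fun _ => forall_congr' fun i => ?_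
  rcases eq_or_ne i b with rfl | h
  · simp [hb]
  · simp [h]

theorem up_subset {A : Finset ι} {T : ℕ} {V : Finset (ι → ℕ)} (hV : V ⊆ piAntidiag A T) :
    up A V ⊆ piAntidiag A (T + 1) := by
  intro g hg
  obtain ⟨b, hb, f, hf, rfl⟩ := mem_up.1 hg
  exact (add_single_mem_piAntidiag hb).2 (hV hf)

theorem link_subset {A : Finset ι} {T : ℕ} {V : Finset (ι → ℕ)} (hV : V ⊆ piAntidiag A (T + 1))
    {b : ι} (hb : b ∈ A) : link V b ⊆ piAntidiag A T :=
  fun _ hf => (add_single_mem_piAntidiag hb).1 (hV (mem_link.1 hf))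

theorem card_link (V : Finset (ι → ℕ)) (b : ι) : #(link V b) = #{f ∈ V | f b ≠ 0} := by
  rw [← card_image_of_injective (link V b) (add_left_injective (Pi.single b 1))]
  congr 1
  ext f
  simp only [mem_image, mem_link, mem_filter]
  refine ⟨?_, fun h => ?_⟩
  · rintro ⟨g, hg, rfl⟩
    simp [hg]
  have e : f - Pi.single b 1 + Pi.single b 1 = f := by
    ext i
    rcases eq_or_ne i b with rfl | hi
    · simp; omega
    · simp [hi]
  exact ⟨f - Pi.single b 1, by rw [e]; exact h.1, e⟩

theorem card_link_add_card_filter (V : Finset (ι → ℕ)) (b : ι) :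
    #(link V b) + #{f ∈ V | f b = 0} = #V := by
  rw [card_link, add_comm]
  exact card_filter_add_card_filter_not (s := V) (fun f => f b = 0)

theorem sum_link (V : Finset (ι → ℕ)) (b : ι) : ∑ f ∈ link V b, (f b + 1) = ∑ g ∈ V, g b := by
  have := sum_preimage (fun f : ι → ℕ => f + Pi.single b 1) V (add_left_injective _).injOn
    (fun g => g b) (by
      intro g _ hg
      by_contra h
      refine hg ⟨g - Pi.single b 1, ?_⟩
      ext i
      rcases eq_or_ne i b with rfl | hi
      · simp; omega
      · simp [hi])
  simpa [link] using this

theorem sum_sum_link {A : Finset ι} {T : ℕ} {V : Finset (ι → ℕ)} (hV : V ⊆ piAntidiag A (T + 1)) :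
    ∑ b ∈ A, ∑ f ∈ link V b, (f b + 1) = (T + 1) * #V := by
  simp_rw [sum_link]
  rw [sum_comm, sum_congr rfl fun g hg => (mem_piAntidiag.1 (hV hg)).1]
  simp [mul_comm]

theorem sum_add_one {A : Finset ι} {T : ℕ} {f : ι → ℕ} (hf : f ∈ piAntidiag A T) :
    ∑ b ∈ A, (f b + 1) = T + #A := by
  rw [sum_add_distrib, (mem_piAntidiag.1 hf).1]
  simp

/-- Local LYM inequality for the lower shadow of multisets. -/
theorem local_lym {A : Finset ι} {T : ℕ} {V W : Finset (ι → ℕ)} (hV : V ⊆ piAntidiag A (T + 1))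
    (hW : W ⊆ piAntidiag A T) (h : ∀ b ∈ A, link V b ⊆ W) : (T + 1) * #V ≤ (T + #A) * #W := by
  rw [← sum_sum_link hV]
  calc ∑ b ∈ A, ∑ f ∈ link V b, (f b + 1) ≤ ∑ b ∈ A, ∑ f ∈ W, (f b + 1) :=
        sum_le_sum fun b hb => sum_le_sum_of_subset (h b hb)
    _ = (T + #A) * #W := by
        rw [sum_comm, sum_congr rfl fun f hf => sum_add_one (hW hf)]
        simp [mul_comm]

theorem succ_mul_card_piAntidiag (A : Finset ι) (T : ℕ) :
    (T + 1) * #(piAntidiag A (T + 1)) = (T + #A) * #(piAntidiag A T) := by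
  rw [← sum_sum_link subset_rfl]
  have : ∀ b ∈ A, link (piAntidiag A (T + 1)) b = piAntidiag A T := by
    intro b hb
    ext f
    rw [mem_link, add_single_mem_piAntidiag hb]
  rw [sum_congr rfl fun b hb => by rw [this b hb], sum_comm,
    sum_congr rfl fun f hf => sum_add_one hf]
  simp [mul_comm]

theorem mem_piAntidiag_of_insert {A : Finset ι} {b : ι} (hb : b ∉ A) {T : ℕ} {f : ι → ℕ} :
    f ∈ piAntidiag A T ↔ f ∈ piAntidiag (insert b A) T ∧ f b = 0 := by
  simp only [mem_piAntidiag, sum_insert hb, mem_insert]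
  constructor
  · rintro ⟨h1, h2⟩
    have : f b = 0 := by
      by_contra h
      exact hb (h2 b h)
    exact ⟨⟨by rw [this, zero_add]; exact h1, fun i hi => Or.inr (h2 i hi)⟩, this⟩
  · rintro ⟨⟨h1, h2⟩, h3⟩
    rw [h3, zero_add] at h1
    refine ⟨h1, fun i hi => (h2 i hi).resolve_left ?_⟩
    rintro rfl
    exact hi h3

theorem card_mul_card_piAntidiag_insert {A : Finset ι} {b : ι} (hb : b ∉ A) (T : ℕ) :
    #A * #(piAntidiag (insert b A) T) = (T + 1) * #(piAntidiag A (T + 1)) := by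
  have h1 := card_link_add_card_filter (piAntidiag (insert b A) (T + 1)) b
  have h2 : link (piAntidiag (insert b A) (T + 1)) b = piAntidiag (insert b A) T := by
    ext f
    rw [mem_link, add_single_mem_piAntidiag (mem_insert_self b A)]
  have h3 : {f ∈ piAntidiag (insert b A) (T + 1) | f b = 0} = piAntidiag A (T + 1) := by
    ext f
    rw [mem_filter, ← mem_piAntidiag_of_insert hb]
  have h4 := succ_mul_card_piAntidiag (insert b A) T
  rw [h2, h3] at h1
  rw [← h1, card_insert_of_notMem hb] at h4
  linarith

/-- In a family closed under replacing any element by `b`, avoiding `b` is not positively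
correlated with being in the family. -/
theorem card_filter_mul_le {A : Finset ι} {b : ι} (hb : b ∉ A) (T : ℕ) :
    ∀ V ⊆ piAntidiag (insert b A) (T + 1),
      (∀ c ∈ A, ∀ f : ι → ℕ, f + Pi.single c 1 ∈ V → f + Pi.single b 1 ∈ V) →
      #{f ∈ V | f b = 0} * #(piAntidiag (insert b A) T) ≤ #(link V b) * #(piAntidiag A (T + 1)) := by
  induction T with
  | zero =>
    intro V hV hs
    have hA : #(piAntidiag A 1) = #A := by
      simpa using succ_mul_card_piAntidiag A 0
    rcases ({f ∈ V | f b = 0}).eq_empty_or_nonempty with h | ⟨f, hf⟩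
    · simp [h]
    have h0 : {f ∈ V | f b = 0} ⊆ piAntidiag A 1 := fun f hf => by
      rw [mem_filter] at hf
      exact (mem_piAntidiag_of_insert hb).2 ⟨hV hf.1, hf.2⟩
    have hl : 1 ≤ #(link V b) := by
      rw [Nat.one_le_iff_ne_zero, Ne, card_eq_zero, ← Ne, ← nonempty_iff_ne_empty]
      have hfs := (mem_piAntidiag.1 (h0 hf)).1
      obtain ⟨c, hc, hfc⟩ : ∃ c ∈ A, f c ≠ 0 := by
        by_contra! h
        rw [sum_eq_zero h] at hfs
        omega
      refine ⟨f - Pi.single c 1, mem_link.2 (hs c hc _ ?_)⟩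
      suffices e : f - Pi.single c 1 + Pi.single c 1 = f by
        rw [e]
        exact (mem_filter.1 hf).1
      ext i
      rcases eq_or_ne i c with rfl | hi
      · simp; omega
      · simp [hi]
    have := card_le_card h0
    simp only [piAntidiag_zero, card_singleton, mul_one, zero_add]
    nlinarith
  | succ T ih =>
    intro V hV hs
    have hW := link_subset hV (mem_insert_self b A)
    have hi := ih (link V b) hW fun c hc f hf => by
      rw [mem_link] at hf ⊢
      rw [add_right_comm] at hf
      exact hs c hc _ hf
    have hl : (T + 1 + 1) * #{f ∈ V | f b = 0} ≤ (T + 1 + #A) * #{f ∈ link V b | f b = 0} := by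
      refine local_lym (A := A) (fun f hf => ?_) (fun f hf => ?_) fun c hc f hf => ?_
      · rw [mem_filter] at hf
        exact (mem_piAntidiag_of_insert hb).2 ⟨hV hf.1, hf.2⟩
      · rw [mem_filter] at hf
        exact (mem_piAntidiag_of_insert hb).2 ⟨hW hf.1, hf.2⟩
      · rw [mem_link, mem_filter] at hf
        rw [mem_filter, mem_link]
        refine ⟨hs c hc _ hf.1, ?_⟩
        have := hf.2
        simp at this
        omega
    have e1 := card_link_add_card_filter (link V b) b
    have e2 := card_mul_card_piAntidiag_insert hb T
    have e3 := card_mul_card_piAntidiag_insert hb (T + 1)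
    have e4 := succ_mul_card_piAntidiag A (T + 1)
    have e5 := succ_mul_card_piAntidiag (insert b A) T
    rw [card_insert_of_notMem hb] at e5
    generalize #(link (link V b) b) = w' at *
    generalize #(link V b) = w at *
    generalize #({f ∈ V | f b = 0}) = v0 at *
    generalize #({f ∈ link V b | f b = 0}) = w0 at *
    generalize #(piAntidiag A (T + 1 + 1)) = N02 at *
    generalize #(piAntidiag A (T + 1)) = N01 at *
    generalize #(piAntidiag (insert b A) (T + 1)) = N11 at *
    generalize #(piAntidiag (insert b A) T) = N10 at *
    generalize #A = m at *
    have hm : w0 * N11 ≤ w * N01 := by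
      have : (T + 1) * (w0 * N11) ≤ (T + 1) * (w * N01) := by
        calc (T + 1) * (w0 * N11) = w0 * ((T + 1) * N11) := by ring
          _ = (T + 1) * (w0 * N10) + w0 * (m * N10) := by rw [e5]; ring
          _ = (T + 1) * (w0 * N10) + w0 * ((T + 1) * N01) := by rw [e2]
          _ ≤ (T + 1) * (w' * N01) + w0 * ((T + 1) * N01) := by gcongr
          _ = (T + 1) * (w * N01) := by rw [← e1]; ring
      exact Nat.le_of_mul_le_mul_left this (by omega)
    have : (T + 1 + 1) * (v0 * N11) ≤ (T + 1 + 1) * (w * N02) := by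
      calc (T + 1 + 1) * (v0 * N11) = ((T + 1 + 1) * v0) * N11 := by ring
        _ ≤ ((T + 1 + m) * w0) * N11 := by gcongr
        _ = (T + 1 + m) * (w0 * N11) := by ring
        _ ≤ (T + 1 + m) * (w * N01) := by gcongr
        _ = w * ((T + 1 + 1) * N02) := by rw [e4]; ring
        _ = (T + 1 + 1) * (w * N02) := by ring
    exact Nat.le_of_mul_le_mul_left this (by omega)

/-- Replace all occurrences of `c` by `b`. -/
def merge (b c : ι) (f : ι → ℕ) : ι → ℕ :=
  Function.update (Function.update f c 0) b (f b + f c)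

theorem merge_left (b c : ι) (f : ι → ℕ) : merge b c f b = f b + f c := by simp [merge]

theorem merge_of_ne {b c i : ι} (f : ι → ℕ) (hb : i ≠ b) (hc : i ≠ c) : merge b c f i = f i := by
  simp [merge, hb, hc]

theorem merge_right {b c : ι} (h : b ≠ c) (f : ι → ℕ) : merge b c f c = 0 := by
  simp [merge, h.symm]

theorem merge_eq_merge_iff {b c : ι} (h : b ≠ c) {f g : ι → ℕ} :
    merge b c f = merge b c g ↔ f b + f c = g b + g c ∧ ∀ i, i ≠ b → i ≠ c → f i = g i := by
  constructor
  · intro e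
    refine ⟨by rw [← merge_left, e, merge_left], fun i hb hc => ?_⟩
    rw [← merge_of_ne f hb hc, e, merge_of_ne g hb hc]
  · rintro ⟨h1, h2⟩
    ext i
    rcases eq_or_ne i b with rfl | hb
    · simpa [merge_left]
    rcases eq_or_ne i c with rfl | hc
    · simp [merge_right h]
    · rw [merge_of_ne f hb hc, merge_of_ne g hb hc, h2 i hb hc]

theorem merge_add_single_of_ne {b c d : ι} (h : b ≠ c) (hd : d ≠ c) (f : ι → ℕ) :
    merge b c (f + Pi.single d 1) = merge b c f + Pi.single d 1 := by
  ext i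
  rcases eq_or_ne i b with rfl | hb
  · simp [merge_left, hd.symm]; omega
  rcases eq_or_ne i c with rfl | hc
  · simp [merge_right h, hd.symm]
  · simp [merge_of_ne _ hb hc]

theorem merge_add_single_right {b c : ι} (h : b ≠ c) (f : ι → ℕ) :
    merge b c (f + Pi.single c 1) = merge b c f + Pi.single b 1 := by
  ext i
  rcases eq_or_ne i b with rfl | hb
  · simp [merge_left, h]; omega
  rcases eq_or_ne i c with rfl | hc
  · simp [merge_right h, h.symm]
  · simp [merge_of_ne _ hb hc, hb, hc]

theorem mem_piAntidiag_of_merge_eq {A : Finset ι} {b c : ι} (h : b ≠ c) (hb : b ∈ A) (hc : c ∈ A)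
    {T : ℕ} {f g : ι → ℕ} (e : merge b c f = merge b c g) (hf : f ∈ piAntidiag A T) :
    g ∈ piAntidiag A T := by
  obtain ⟨e1, e2⟩ := (merge_eq_merge_iff h).1 e
  rw [mem_piAntidiag] at hf ⊢
  have hc' : c ∈ A.erase b := mem_erase.2 ⟨h.symm, hc⟩
  constructor
  · rw [← hf.1, ← add_sum_erase A f hb, ← add_sum_erase A g hb, ← add_sum_erase _ f hc',
      ← add_sum_erase _ g hc', ← add_assoc, ← add_assoc, e1]
    congr 1
    refine sum_congr rfl fun i hi => ?_
    simp only [mem_erase] at hi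
    exact (e2 i hi.2.1 hi.1).symm
  · intro i hi
    by_cases h1 : i = b
    · rwa [h1]
    by_cases h2 : i = c
    · rwa [h2]
    exact hf.2 i (by rwa [e2 i h1 h2])

theorem eq_of_merge_eq {b c : ι} (h : b ≠ c) {f g : ι → ℕ} (e : merge b c f = merge b c g)
    (hc : f c = g c) : f = g := by
  obtain ⟨e1, e2⟩ := (merge_eq_merge_iff h).1 e
  ext i
  by_cases h1 : i = b
  · subst h1; omega
  by_cases h2 : i = c
  · rwa [h2]
  · exact e2 i h1 h2

/-- Compression of a family towards `b` along `c`: the members with the same image under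
`merge b c` are replaced by equally many multisets with the fewest copies of `c`. -/
def compress (A : Finset ι) (T : ℕ) (b c : ι) (V : Finset (ι → ℕ)) : Finset (ι → ℕ) :=
  {f ∈ piAntidiag A T | f c < #{g ∈ V | merge b c g = merge b c f}}

theorem card_compress_fiber {A : Finset ι} {T : ℕ} {b c : ι} (h : b ≠ c) (hb : b ∈ A) (hc : c ∈ A)
    {V : Finset (ι → ℕ)} (hV : V ⊆ piAntidiag A T) (r : ι → ℕ) :
    #{f ∈ compress A T b c V | merge b c f = r} = #{f ∈ V | merge b c f = r} := by
  rcases ({f ∈ V | merge b c f = r}).eq_empty_or_nonempty with h0 | ⟨f₀, hf₀⟩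
  · rw [h0, card_empty, card_eq_zero, filter_eq_empty_iff]
    rintro f hf rfl
    rw [compress, mem_filter, h0] at hf
    simp at hf
  rw [mem_filter] at hf₀
  obtain ⟨hf₀, rfl⟩ := hf₀
  set r := merge b c f₀ with hr
  set k := #{f ∈ V | merge b c f = r} with hk
  have hk' : k ≤ r b + 1 := by
    rw [← card_range (r b + 1)]
    refine card_le_card_of_injOn (fun f => f c) (fun f hf => ?_) fun f hf g hg e => ?_
    · simp only [coe_filter, Set.mem_ofPred_eq] at hf
      have := merge_left b c f
      rw [hf.2] at this
      simp only [coe_range, Set.mem_Iio]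
      omega
    · simp only [coe_filter, Set.mem_ofPred_eq] at hf hg
      exact eq_of_merge_eq h (hf.2.trans hg.2.symm) e
  rw [← card_range k]
  refine card_nbij (fun f => f c) (fun f hf => ?_) (fun f hf g hg e => ?_) fun i hi => ?_
  · simp only [coe_filter, Set.mem_ofPred_eq, compress, mem_filter] at hf
    rw [hf.2] at hf
    exact mem_coe.2 (mem_range.2 hf.1.2)
  · simp only [coe_filter, Set.mem_ofPred_eq] at hf hg
    exact eq_of_merge_eq h (hf.2.trans hg.2.symm) e
  · simp only [coe_range, Set.mem_Iio] at hi
    have e : merge b c (Function.update (Function.update r c i) b (r b - i)) = r := by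
      rw [hr, merge_eq_merge_iff h]
      have := merge_left b c f₀
      have hrb : r b = merge b c f₀ b := rfl
      constructor
      · simp only [Function.update_self, ne_eq, h.symm, not_false_eq_true, Function.update_of_ne]
        omega
      · intro j hj1 hj2
        simp [hj1, hj2, merge_of_ne]
    have ec : Function.update (Function.update r c i) b (r b - i) c = i := by simp [h.symm]
    refine ⟨Function.update (Function.update r c i) b (r b - i), ?_, ec⟩
    simp only [coe_filter, Set.mem_ofPred_eq, compress, mem_filter]
    refine ⟨⟨mem_piAntidiag_of_merge_eq h hb hc e.symm (hV hf₀), ?_⟩, e⟩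
    rw [e, ec]
    exact hi

theorem sum_compress_comp_merge {A : Finset ι} {T : ℕ} {b c : ι} (h : b ≠ c) (hb : b ∈ A)
    (hc : c ∈ A) {V : Finset (ι → ℕ)} (hV : V ⊆ piAntidiag A T) {M : Type*} [AddCommMonoid M]
    (F : (ι → ℕ) → M) :
    ∑ f ∈ compress A T b c V, F (merge b c f) = ∑ f ∈ V, F (merge b c f) := by
  have key : ∀ r, r ∈ (compress A T b c V).image (merge b c) ↔ r ∈ V.image (merge b c) := by
    intro r
    simp only [mem_image, ← filter_nonempty_iff, ← card_pos, card_compress_fiber h hb hc hV]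
  rw [sum_comp F (merge b c), sum_comp F (merge b c), Finset.ext key]
  simp_rw [card_compress_fiber h hb hc hV]

theorem card_compress {A : Finset ι} {T : ℕ} {b c : ι} (h : b ≠ c) (hb : b ∈ A)
    (hc : c ∈ A) {V : Finset (ι → ℕ)} (hV : V ⊆ piAntidiag A T) :
    #(compress A T b c V) = #V := by
  rw [card_eq_sum_ones, card_eq_sum_ones]
  exact sum_compress_comp_merge h hb hc hV fun _ => 1

theorem up_compress_subset {A : Finset ι} {T : ℕ} {b c : ι} (h : b ≠ c) (hb : b ∈ A)
    (hc : c ∈ A) (V : Finset (ι → ℕ)) :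
    up A (compress A T b c V) ⊆ compress A (T + 1) b c (up A V) := by
  intro g hg
  obtain ⟨d, hd, f, hf, rfl⟩ := mem_up.1 hg
  simp only [compress, mem_filter] at hf ⊢
  refine ⟨(add_single_mem_piAntidiag hd).2 hf.1, ?_⟩
  rcases eq_or_ne d c with rfl | hdc
  · rw [merge_add_single_right h]
    have hpos : 0 < #{g ∈ V | merge b d g = merge b d f} := by omega
    obtain ⟨h₀, hh₀, hmax⟩ := exists_max_image _ (fun g : ι → ℕ => g d) (card_pos.1 hpos)
    have hn : h₀ + Pi.single d 1 ∉
        ({g ∈ V | merge b d g = merge b d f}).image (fun g => g + Pi.single b 1) := by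
      intro hm
      obtain ⟨g, hg, e⟩ := mem_image.1 hm
      have := congrFun e d
      have := hmax g hg
      simp [h.symm] at *
      omega
    have hle := card_le_card (s := insert (h₀ + Pi.single d 1)
        (({g ∈ V | merge b d g = merge b d f}).image (fun g => g + Pi.single b 1)))
      (t := {g ∈ up A V | merge b d g = merge b d f + Pi.single b 1}) (by
        intro x hx
        rw [mem_filter]
        rcases mem_insert.1 hx with rfl | hx
        · rw [mem_filter] at hh₀
          exact ⟨add_single_mem_up hc hh₀.1, by rw [merge_add_single_right h, hh₀.2]⟩
        · obtain ⟨g, hg, rfl⟩ := mem_image.1 hx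
          rw [mem_filter] at hg
          exact ⟨add_single_mem_up hb hg.1, by rw [merge_add_single_of_ne h h, hg.2]⟩)
    rw [card_insert_of_notMem hn, card_image_of_injective _ (add_left_injective _)] at hle
    simp
    omega
  · rw [merge_add_single_of_ne h hdc]
    have e : (f + Pi.single d 1 : ι → ℕ) c = f c := by simp [hdc.symm]
    rw [e]
    refine hf.2.trans_le ?_
    refine card_le_card_of_injOn (fun g => g + Pi.single d 1) (fun g hg => ?_)
      (add_left_injective _).injOn
    simp only [coe_filter, Set.mem_ofPred_eq] at hg ⊢
    exact ⟨add_single_mem_up hd hg.1, by rw [merge_add_single_of_ne h hdc, hg.2]⟩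

theorem card_up_compress_le {A : Finset ι} {T : ℕ} {b c : ι} (h : b ≠ c) (hb : b ∈ A)
    (hc : c ∈ A) {V : Finset (ι → ℕ)} (hV : V ⊆ piAntidiag A T) :
    #(up A (compress A T b c V)) ≤ #(up A V) :=
  (card_le_card (up_compress_subset h hb hc V)).trans_eq (card_compress h hb hc (up_subset hV))

theorem sum_lt_sum_compress {A : Finset ι} {T : ℕ} {b c : ι} (h : b ≠ c) (hb : b ∈ A)
    (hc : c ∈ A) {V : Finset (ι → ℕ)} (hV : V ⊆ piAntidiag A T) (hne : compress A T b c V ≠ V) :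
    ∑ f ∈ V, f b < ∑ f ∈ compress A T b c V, f b := by
  set C := compress A T b c V with hC
  let G : (ι → ℕ) → ℤ := fun r => (r b : ℤ) - #{g ∈ V | merge b c g = r}
  have hG : ∑ f ∈ C, G (merge b c f) = ∑ f ∈ V, G (merge b c f) :=
    sum_compress_comp_merge h hb hc hV G
  have hmem : ∀ f ∈ piAntidiag A T, f ∈ C ↔ 0 < (f b : ℤ) - G (merge b c f) := by
    intro f hf
    simp only [hC, compress, mem_filter, hf, true_and, G, merge_left]
    push_cast
    omega
  have hCL : C ⊆ piAntidiag A T := filter_subset _ _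
  have hcard : #C = #V := card_compress h hb hc hV
  have hnon : (C \ V).Nonempty := by
    rw [sdiff_nonempty]
    intro hs
    exact hne (eq_of_subset_of_card_le hs hcard.ge)
  have h1 : ∑ f ∈ V \ C, ((f b : ℤ) - G (merge b c f)) ≤ 0 :=
    sum_nonpos fun f hf => by
      have := (hmem f (hV (mem_sdiff.1 hf).1)).not.1 (mem_sdiff.1 hf).2
      omega
  have h2 : 0 < ∑ f ∈ C \ V, ((f b : ℤ) - G (merge b c f)) :=
    sum_pos (fun f hf => (hmem f (hCL (mem_sdiff.1 hf).1)).1 (mem_sdiff.1 hf).1) hnon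
  have h3 := sum_sdiff_sub_sum_sdiff (s₁ := V) (s₂ := C)
    (f := fun f => (f b : ℤ) - G (merge b c f))
  rw [sum_sub_distrib (s := C), sum_sub_distrib (s := V), hG] at h3
  zify
  linarith

theorem exists_stable {A : Finset ι} {T : ℕ} {b : ι} (hb : b ∈ A) (n : ℕ) :
    ∀ V ⊆ piAntidiag A T, T * #V - ∑ f ∈ V, f b = n →
      ∃ V' ⊆ piAntidiag A T, #V' = #V ∧ #(up A V') ≤ #(up A V) ∧
        ∀ c ∈ A, ∀ f : ι → ℕ, f + Pi.single c 1 ∈ V' → f + Pi.single b 1 ∈ V' := by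
  induction n using Nat.strong_induction_on with
  | _ n ih =>
  intro V hV hn
  by_cases hs : ∀ c ∈ A, ∀ f : ι → ℕ, f + Pi.single c 1 ∈ V → f + Pi.single b 1 ∈ V
  · exact ⟨V, hV, rfl, le_rfl, hs⟩
  push Not at hs
  obtain ⟨c, hc, f, hf1, hf2⟩ := hs
  have h : b ≠ c := by
    rintro rfl
    exact hf2 hf1
  have hne : compress A T b c V ≠ V := by
    intro e
    apply hf2
    rw [← e] at hf1 ⊢
    simp only [compress, mem_filter] at hf1 ⊢
    have em : merge b c (f + Pi.single b 1) = merge b c (f + Pi.single c 1) := by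
      rw [merge_add_single_right h, merge_add_single_of_ne h h]
    refine ⟨mem_piAntidiag_of_merge_eq h hb hc em.symm hf1.1, ?_⟩
    rw [em]
    refine lt_of_le_of_lt ?_ hf1.2
    simp [h.symm]
  have hlt := sum_lt_sum_compress h hb hc hV hne
  have hCL : compress A T b c V ⊆ piAntidiag A T := filter_subset _ _
  have hcard := card_compress h hb hc hV
  have hbd : ∑ f ∈ compress A T b c V, f b ≤ T * #V := by
    rw [← hcard, mul_comm, ← smul_eq_mul]
    refine sum_le_card_nsmul _ _ _ fun f hf => ?_
    rw [← (mem_piAntidiag.1 (hCL hf)).1]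
    exact single_le_sum (f := f) (fun _ _ => Nat.zero_le _) hb
  obtain ⟨V', h1, h2, h3, h4⟩ := ih _ (by rw [hcard]; omega) _ hCL rfl
  exact ⟨V', h1, h2.trans hcard, h3.trans (card_up_compress_le h hb hc hV), h4⟩

theorem growth_step_density {t m A a : ℝ} (ht : 1 ≤ t) (hm : 0 ≤ m) (ha : 0 ≤ a) (haA : a ≤ A)
    (hA : A ≤ 1) :
    (t + m + 1) * (t * A + m * a) * ((t - 1 + A) * (t + a)) ≤
      (t * A * (t + a) + m * a * (t - 1 + A)) * (t * (t + m) + t * A + m * a) := by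
  have h1 : 0 ≤ (1 - A) * ((A - a) * t ^ 2 * (m + 1) + a * (t + m) * (t + A)) := by
    have : 0 ≤ 1 - A := by linarith
    have : 0 ≤ A - a := by linarith
    have : 0 ≤ A := by linarith
    positivity
  have h2 : 0 ≤ m * (t ^ 2 - 1 + A) * a * (A - a) := by
    have : 0 ≤ A - a := by linarith
    have : 0 ≤ t ^ 2 - 1 + A := by nlinarith
    positivity
  linear_combination h1 + h2

theorem growth_step {t m M N w v p q : ℝ} (ht : 1 ≤ t) (hm : 0 ≤ m) (hM : 0 < M)
    (hN : m * M = t * N) (hw : 0 ≤ w) (hwM : w ≤ M) (hv : 0 ≤ v) (hvN : v ≤ N)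
    (hd : v * M ≤ w * N) (hp0 : 0 ≤ p) (hq0 : 0 ≤ q)
    (hp : (t + m) * M * w ≤ p * ((t - 1) * M + w)) (hq : (t + m) * N * v ≤ q * (t * N + v)) :
    (t + m + 1) * (M + N) * (w + v) ≤ (p + q) * (t * (M + N) + (w + v)) := by
  have ht0 : 0 < t := by linarith
  have hN0 : 0 ≤ N := hv.trans hvN
  rcases hw.eq_or_lt with rfl | hw0
  · have : v = 0 := by nlinarith
    subst this
    simp only [add_zero, mul_zero]
    positivity
  have hX : 0 < (t - 1) * M + w := by nlinarith
  rcases hN0.eq_or_lt with rfl | hN0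
  · have hv0 : v = 0 := le_antisymm hvN hv
    have hm0 : m = 0 := by
      rw [mul_zero] at hN
      exact (mul_eq_zero.1 hN).resolve_right hM.ne'
    subst hv0 hm0
    simp only [add_zero] at *
    refine le_of_mul_le_mul_right ?_ hX
    calc (t + 1) * M * w * ((t - 1) * M + w)
        = t * M * w * (t * M + w) - M * w * (M - w) := by ring
      _ ≤ t * M * w * (t * M + w) := by
          have : 0 ≤ M * w * (M - w) := mul_nonneg (by positivity) (by linarith)
          linarith
      _ ≤ p * ((t - 1) * M + w) * (t * M + w) := by gcongr
      _ ≤ (p + q) * ((t - 1) * M + w) * (t * M + w) := by gcongr; linarith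
      _ = (p + q) * (t * M + w) * ((t - 1) * M + w) := by ring
  have hY : 0 < t * N + v := by positivity
  refine le_of_mul_le_mul_right ?_ (mul_pos hX hY)
  have key := growth_step_density (t := t) (m := m) (A := w / M) (a := v / N) ht hm
    (by positivity) (by rw [div_le_div_iff₀ hN0 hM]; exact hd) (by rw [div_le_one hM]; exact hwM)
  obtain ⟨A, rfl⟩ : ∃ A, w = A * M := ⟨w / M, by field_simp⟩
  obtain ⟨a, rfl⟩ : ∃ a, v = a * N := ⟨v / N, by field_simp⟩
  rw [mul_div_cancel_right₀ _ hM.ne', mul_div_cancel_right₀ _ hN0.ne'] at key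
  have key' := mul_le_mul_of_nonneg_left key
    (show 0 ≤ (t + m) * (M ^ 3 * N / t ^ 2) by positivity)
  have hN' : N = m * M / t := by
    field_simp
    linarith
  calc (t + m + 1) * (M + N) * (A * M + a * N) * (((t - 1) * M + A * M) * (t * N + a * N))
      = (t + m) * (M ^ 3 * N / t ^ 2) *
          ((t + m + 1) * (t * A + m * a) * ((t - 1 + A) * (t + a))) := by
        rw [hN']
        field_simp
    _ ≤ _ := key'
    _ = ((t + m) * M * (A * M) * (t * N + a * N)
          + (t + m) * N * (a * N) * ((t - 1) * M + A * M)) * (t * (M + N) + (A * M + a * N)) := by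
        rw [hN']
        field_simp
        ring
    _ ≤ (p * ((t - 1) * M + A * M) * (t * N + a * N)
          + q * (t * N + a * N) * ((t - 1) * M + A * M)) * (t * (M + N) + (A * M + a * N)) := by
        gcongr
    _ = _ := by ring

/-- Macaulay-type lower bound for the growth of a family of multisets of size `T`. -/
theorem card_up_lower_bound (A : Finset ι) : ∀ (T : ℕ), ∀ V ⊆ piAntidiag A T,
    ((T : ℝ) + #A) * #(piAntidiag A T) * #V ≤ #(up A V) * (T * #(piAntidiag A T) + #V) := by
  induction A using Finset.induction with
  | empty =>
    intro T V hV
    rcases eq_or_ne T 0 with rfl | hT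
    · simp
      positivity
    · rw [piAntidiag_empty_of_ne_zero hT] at *
      simp
      positivity
  | insert b A hb ihA =>
    intro T
    induction T with
    | zero =>
      intro V hV
      rw [piAntidiag_zero] at *
      rcases subset_singleton_iff.1 hV with rfl | rfl
      · simp
      · have : #(up (insert b A) {(0 : ι → ℕ)}) = #(insert b A) := by
          have e : up (insert b A) {(0 : ι → ℕ)} = (insert b A).image fun c => Pi.single c 1 := by
            ext g
            simp [mem_up, eq_comm]
          rw [e, card_image_of_injective]
          intro c d h
          by_contra hcd
          have := congrFun h c
          simp [hcd] at this
        rw [this]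
        simp
    | succ T ihT =>
      intro V₀ hV₀
      obtain ⟨V, hV, hcard, hup, hs⟩ := exists_stable (mem_insert_self b A) _ V₀ hV₀ rfl
      have hW := link_subset hV (mem_insert_self b A)
      have hZ : {f ∈ V | f b = 0} ⊆ piAntidiag A (T + 1) := fun f hf => by
        rw [mem_filter] at hf
        exact (mem_piAntidiag_of_insert hb).2 ⟨hV hf.1, hf.2⟩
      have e1 := card_link_add_card_filter V b
      have hU : #(up (insert b A) (link V b)) + #(up A {f ∈ V | f b = 0})
          ≤ #(up (insert b A) V) := by
        rw [← card_link_add_card_filter (up (insert b A) V) b]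
        refine add_le_add (card_le_card fun g hg => ?_) (card_le_card fun g hg => ?_)
        · obtain ⟨c, hc, f, hf, rfl⟩ := mem_up.1 hg
          rw [mem_link, add_right_comm]
          exact add_single_mem_up hc (mem_link.1 hf)
        · obtain ⟨c, hc, f, hf, rfl⟩ := mem_up.1 hg
          rw [mem_filter] at hf ⊢
          refine ⟨add_single_mem_up (mem_insert_of_mem hc) hf.1, ?_⟩
          have : b ≠ c := by
            rintro rfl
            exact hb hc
          simp [hf.2, this]
      have e2 := card_mul_card_piAntidiag_insert hb T
      have e3 := succ_mul_card_piAntidiag (insert b A) T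
      rw [card_insert_of_notMem hb] at e3
      have e4 : #(piAntidiag (insert b A) (T + 1))
          = #(piAntidiag (insert b A) T) + #(piAntidiag A (T + 1)) :=
        Nat.eq_of_mul_eq_mul_left (by omega : 0 < T + 1) (by rw [e3, mul_add, ← e2]; ring)
      have hpos : 0 < #(piAntidiag (insert b A) T) := by
        refine card_pos.2 ⟨Pi.single b T, mem_piAntidiag.2 ⟨by simp, fun i hi => ?_⟩⟩
        by_contra h
        refine hi (Pi.single_eq_of_ne ?_ _)
        rintro rfl
        exact h (mem_insert_self _ _)
      have ih1 := ihT _ hW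
      have ih2 := ihA (T + 1) _ hZ
      rw [card_insert_of_notMem hb] at ih1 ⊢
      have key := growth_step (t := (T : ℝ) + 1) (m := #A)
        (M := #(piAntidiag (insert b A) T)) (N := #(piAntidiag A (T + 1)))
        (w := #(link V b)) (v := #{f ∈ V | f b = 0})
        (p := #(up (insert b A) (link V b))) (q := #(up A {f ∈ V | f b = 0}))
        (by linarith [(Nat.cast_nonneg T : (0 : ℝ) ≤ T)]) (by positivity) (by exact_mod_cast hpos)
        (by exact_mod_cast e2) (by positivity) (by exact_mod_cast card_le_card hW)
        (by positivity) (by exact_mod_cast card_le_card hZ)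
        (by exact_mod_cast card_filter_mul_le hb T V hV fun c hc => hs c (mem_insert_of_mem hc)) (by positivity) (by positivity)
        (by push_cast at ih1; linarith) (by push_cast at ih2; linarith)
      rw [← hcard, ← e1, e4]
      push_cast
      refine le_trans (le_of_eq (by ring)) (key.trans ?_)
      gcongr
      exact_mod_cast hU.trans hup

end MultisetShadow

/-- The uniform measure on a level is given by counting. -/
theorem multisetUniform_real {B : Type*} [Fintype B] [DecidableEq B] (T : ℕ) (S : Set (B → ℕ))
    [DecidablePred (· ∈ S)] :
    (multisetUniform B T).real S = ((Finset.piAntidiag Finset.univ T).filter (· ∈ S)).card /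
      (Finset.piAntidiag (Finset.univ : Finset B) T).card := by
  have e : multisetLevel (Set.univ : Set (B → ℕ)) T
      = ↑(Finset.piAntidiag (Finset.univ : Finset B) T) := by
    ext f
    simp [multisetLevel]
  have hi : (↑(Finset.piAntidiag (Finset.univ : Finset B) T) : Set (B → ℕ)) ∩ S
      = ↑((Finset.piAntidiag Finset.univ T).filter (· ∈ S)) := by
    ext f
    simp
  rw [multisetUniform, e, Measure.real, ← uniformOn_inter_self (Finset.finite_toSet _), hi,
    uniformOn_apply_finset, Finset.inter_eq_right.2 (Finset.filter_subset _ _)]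
  simp

theorem theorem1 {B : Type*} [Fintype B] [DecidableEq B] [Nonempty B]
    (T : ℕ) (x : ℝ) (hx : 0 ≤ x) (S : Set (B → ℕ))
    (hS : (multisetUniform B (T + 1)).real S ≥ x / ((T : ℝ) + 1 + x)) :
    (multisetUniform B T).real (multisetShadow S) ≥ x / ((T : ℝ) + x) := by
  classical
  have hT0 : (0 : ℝ) ≤ T := Nat.cast_nonneg T
  rcases (add_nonneg hT0 hx).eq_or_lt with h0 | h0
  · rw [← h0, div_zero]
    exact measureReal_nonneg
  have hpos : ∀ n : ℕ, 0 < (Finset.piAntidiag (Finset.univ : Finset B) n).card := fun n =>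
    Finset.card_pos.2 ⟨Pi.single (Classical.arbitrary B) n, by simp [Finset.mem_piAntidiag, Finset.sum_pi_single']⟩
  rw [multisetUniform_real] at hS ⊢
  set L := Finset.piAntidiag (Finset.univ : Finset B) T with hL
  set L' := Finset.piAntidiag (Finset.univ : Finset B) (T + 1) with hL'
  set V := L.filter (· ∉ multisetShadow S) with hV
  have hVL : V ⊆ L := Finset.filter_subset _ _
  have main := MultisetShadow.card_up_lower_bound Finset.univ T V hVL
  have hU : (MultisetShadow.up Finset.univ V).card ≤ (L'.filter (· ∉ S)).card := by
    refine Finset.card_le_card fun g hg => ?_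
    rw [Finset.mem_filter]
    refine ⟨MultisetShadow.up_subset hVL hg, fun hgS => ?_⟩
    obtain ⟨b, -, f, hf, rfl⟩ := MultisetShadow.mem_up.1 hg
    exact (Finset.mem_filter.1 hf).2 ⟨b, hgS⟩
  have c1 := Finset.card_filter_add_card_filter_not (s := L) (· ∈ multisetShadow S)
  have c2 := Finset.card_filter_add_card_filter_not (s := L') (· ∈ S)
  have c3 := MultisetShadow.succ_mul_card_piAntidiag (Finset.univ : Finset B) T
  have p1 := hpos T
  have p2 := hpos (T + 1)
  rw [← hL, ← hL'] at c3
  rw [← hL] at main p1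
  rw [← hL'] at p2
  rw [ge_iff_le, div_le_div_iff₀ (by positivity) (by exact_mod_cast p2)] at hS
  rw [ge_iff_le, div_le_div_iff₀ h0 (by exact_mod_cast p1)]
  rw [← hV] at c1
  generalize (L.filter (· ∈ multisetShadow S)).card = d at *
  generalize (L'.filter (· ∈ S)).card = s at *
  generalize (L'.filter (· ∉ S)).card = u' at *
  generalize (MultisetShadow.up Finset.univ V).card = u at *
  generalize V.card = v at *
  generalize L.card = N at *
  generalize L'.card = N' at *
  replace hU : (u : ℝ) ≤ u' := by exact_mod_cast hU
  replace c1 : (d : ℝ) + v = N := by exact_mod_cast c1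
  replace c2 : (s : ℝ) + u' = N' := by exact_mod_cast c2
  replace c3 : ((T : ℝ) + 1) * N' = (T + (Finset.univ : Finset B).card) * N := by exact_mod_cast c3
  replace p1 : (0 : ℝ) < N := by exact_mod_cast p1
  replace p2 : (0 : ℝ) < N' := by exact_mod_cast p2
  rw [← c3] at main
  have h1 : (u : ℝ) * (T + 1 + x) ≤ (T + 1) * N' := by nlinarith
  have h2 : ((T : ℝ) + 1) * N' * (v * (T + 1 + x)) ≤ (T + 1) * N' * (T * N + v) :=
    calc ((T : ℝ) + 1) * N' * (v * (T + 1 + x)) = (T + 1) * N' * v * (T + 1 + x) := by ring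
      _ ≤ u * (T * N + v) * (T + 1 + x) := by gcongr
      _ = u * (T + 1 + x) * (T * N + v) := by ring
      _ ≤ (T + 1) * N' * (T * N + v) := by gcongr
  have h3 := le_of_mul_le_mul_left h2 (by positivity)
  nlinarith
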